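/- Let $(M,d)$ be a complete, bounded NPC space with diameter $\mathrm{diam}(M)>0$, equipped with its Borel $\sigma$-algebra. Here a geodesic is a path $\gamma:[0,1]\to M$ with $d(\gamma(s),\gamma(t))=(t-s)\,d(\gamma(0),\gamma(1))$ for all $0\le s\le t\le 1$, and $M$ is NPC if any two points are joined by a geodesic and, for every $p\in M$, every geodesic $\gamma$ from $x$ to $y$ and every $t\in[0,1]$, $$d^2(p,\gamma(t))\le(1-t)\,d^2(p,x)+t\,d^2(p,y)-t(1-t)\,d^2(x,y).$$ Let $\Theta$ be a measurable space (the set of experts) and $\pi$ a probability measure on $\Theta$ (the prior). Let $z_1,z_2,\dots\in M$ be an arbitrary outcome sequence and let $\theta\mapsto m_{\theta,t}\in M$, $t\ge 1$, be arbitrary measurable maps (the expert advice). For the loss $\ell(m,z)=d^2(m,z)$ put $L_{\theta,T}=\sum_{t=1}^T d^2(m_{\theta,t},z_t)$, with $L_{\theta,0}=0$. With $\beta=\frac{1}{2\,\mathrm{diam}(M)^2}$, let $(\hat m_t)_{t\ge 1}$ be a generalized exponentially weighted average (EWA) forecaster, that is, for every $t\ge1$, $$\hat m_t\in\underset{m\in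 M}{\arg\min}\int_\Theta d^2(m,m_{\theta,t})\,\mathrm d\pi_t(\theta),\qquad \mathrm d\pi_t(\theta)=\frac{e^{-\beta L_{\theta,t-1}}\,\mathrm d\pi(\theta)}{\int_\Theta e^{-\beta L_{\vartheta,t-1}}\,\mathrm d\pi(\vartheta)},$$ and put $\hat L_T=\sum_{t=1}^T d^2(\hat m_t,z_t)$. Then, for every $T$, $$\hat L_T\le\inf_q\left\{\int_\Theta L_{\theta,T}\,\mathrm dq(\theta)+2\,\mathrm{diam}(M)^2\,D(q\|\pi)\right\},$$ where the infimum runs over all probability measures $q$ on $\Theta$ and $D(q\|\pi)\in[0,+\infty]$ is the Kullback–Leibler divergence, $D(q\|\pi)=\int_\Theta\ln\frac{\mathrm dq}{\mathrm d\pi}\,\mathrm dq$ if $q\ll\pi$ and $+\infty$ otherwise. In particular, if $\Theta$ is finite with $K$ elements (with the discrete $\sigma$-algebra) and $\pi$ is the uniform prior, then the regret satisfies $$R_T=\hat L_T-\min_{\theta\in\Theta}L_{\theta,T}\le 2\,\mathrm{diam}(M)^2\ln K.$$ -/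

import Mathlib

open MeasureTheory

noncomputable section

namespace OnlineNPC

/-- A geodesic `γ : [0,1] → M`: `d(γ s, γ t) = (t - s) d(γ 0, γ 1)` for all `0 ≤ s ≤ t ≤ 1`.
Such a map is Lipschitz, so its continuity (see `IsGeodesic.continuous`) is not a separate
requirement. -/
def IsGeodesic {M : Type*} [MetricSpace M] (γ : unitInterval → M) : Prop :=
  ∀ s t : unitInterval, s ≤ t →
    dist (γ s) (γ t) = ((t : ℝ) - (s : ℝ)) * dist (γ 0) (γ 1)

theorem IsGeodesic.continuous {M : Type*} [MetricSpace M] {γ : unitInterval → M}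
    (h : IsGeodesic γ) : Continuous γ := by
  have key : ∀ s t : unitInterval, dist (γ s) (γ t) ≤ dist (γ 0) (γ 1) * dist s t := by
    intro s t
    rcases le_total s t with hst | hst
    · rw [h s t hst, mul_comm, Subtype.dist_eq, Real.dist_eq, abs_sub_comm]
      exact mul_le_mul_of_nonneg_left (le_abs_self _) dist_nonneg
    · rw [dist_comm (γ s), h t s hst, mul_comm, Subtype.dist_eq, Real.dist_eq]
      exact mul_le_mul_of_nonneg_left (le_abs_self _) dist_nonneg
  exact (LipschitzWith.of_dist_le_mul (K := ⟨dist (γ 0) (γ 1), dist_nonneg⟩) key).continuous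

/-- `M` is a geodesic metric space: any two points are joined by a geodesic. -/
def IsGeodesicSpace (M : Type*) [MetricSpace M] : Prop :=
  ∀ x y : M, ∃ γ : unitInterval → M, IsGeodesic γ ∧ γ 0 = x ∧ γ 1 = y

/-- `M` is an NPC space: a geodesic space of non-positive curvature in the sense of Alexandrov. -/
structure IsNPC (M : Type*) [MetricSpace M] : Prop where
  geodesicSpace : IsGeodesicSpace M
  curv_nonpos : ∀ (p x y : M) (γ : unitInterval → M), IsGeodesic γ → γ 0 = x → γ 1 = y →
    ∀ t : unitInterval,
      dist p (γ t) ^ 2 ≤ (1 - (t : ℝ)) * dist p x ^ 2 + (t : ℝ) * dist p y ^ 2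
        - (t : ℝ) * (1 - (t : ℝ)) * dist x y ^ 2

/-- Cumulative loss `∑_{t=1}^T ℓ(a_t, z_t)` of a sequence of decisions (rounds are numbered from
`1`; the value at `T = 0` is `0`). -/
def cumLoss {M Z : Type*} (ℓ : M → Z → ℝ) (a : ℕ → M) (z : ℕ → Z) (T : ℕ) : ℝ :=
  ∑ t ∈ Finset.Icc 1 T, ℓ (a t) (z t)

/-- Cumulative loss `L_{θ,T}` of expert `θ`, where `m t θ` is the advice of `θ` at round `t`. -/
def expertLoss {Θ M Z : Type*} (ℓ : M → Z → ℝ) (m : ℕ → Θ → M) (z : ℕ → Z) (θ : Θ) (T : ℕ) : ℝ :=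
  cumLoss ℓ (fun t => m t θ) z T

/-- The regret `R_T`: cumulative loss of the forecaster minus that of the best expert. -/
def regret {Θ M Z : Type*} (ℓ : M → Z → ℝ) (mhat : ℕ → M) (m : ℕ → Θ → M) (z : ℕ → Z)
    (T : ℕ) : ℝ :=
  cumLoss ℓ mhat z T - ⨅ θ, expertLoss ℓ m z θ T

/-- The weights at round `t ≥ 1`:
`dπ_t(θ) = exp(-β_t L_{θ,t-1}) dπ(θ) / ∫ exp(-β_t L_{ϑ,t-1}) dπ(ϑ)`. -/
def expWeights {Θ M Z : Type*} [MeasurableSpace Θ] (ℓ : M → Z → ℝ) (π : Measure Θ) (β : ℕ → ℝ)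
    (m : ℕ → Θ → M) (z : ℕ → Z) (t : ℕ) : Measure Θ :=
  π.tilted (fun θ => -(β t) * expertLoss ℓ m z θ (t - 1))

/-- `mhat` is a generalized exponentially weighted average forecaster with prior `π` and tuning
parameters `β`: at each round `t ≥ 1`, `mhat t` minimizes
`a ↦ ∫ d(a, m_{θ,t})² dπ_t(θ)` over the decision space. -/
def IsEWAForecaster {Θ M Z : Type*} [MeasurableSpace Θ] [MetricSpace M] (ℓ : M → Z → ℝ)
    (π : Measure Θ) (β : ℕ → ℝ) (m : ℕ → Θ → M) (z : ℕ → Z) (mhat : ℕ → M) : Prop :=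
  ∀ t, 1 ≤ t →
    IsMinOn (fun a : M => ∫ θ, dist a (m t θ) ^ 2 ∂(expWeights ℓ π β m z t)) Set.univ (mhat t)

/-- The squared distance loss `ℓ(m, z) = d(m, z)²`. -/
def sqDistLoss (M : Type*) [MetricSpace M] : M → M → ℝ := fun a z => dist a z ^ 2

end OnlineNPC

end

/-! With `D` the diameter and `β = 1/(2D²)`, the heart is a mixability bound: if `b` is a barycenter
of `X`, then `E exp(-β d²(X,z)) ≤ exp(-β d²(b,z))`. Along a geodesic from `b` to `z`, a difference
quotient of `d²(·,x)` plays the role of the inner product `⟨x-b, z-b⟩`; a scalar inequality bounds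
the exponential by an expression affine in this quotient, whose mean has a nonpositive limit by
minimality of `b` (`integral_exp_neg_sq_dist_le`). Applied to the weights of each round, the bound
telescopes to `∫ exp(-β L_{θ,T}) dπ ≤ exp(-β L̂_T)`. Donsker–Varadhan turns this into the bound for
every `q`; for a uniform prior, keeping only the best expert's atom suffices. -/

namespace OnlineNPC

/-- Euclidean model: `u = ⟨x-b, z-b⟩/D²`, `v = |x-b|/D`, `w = |z-b|/D`. The hypotheses are then
Cauchy–Schwarz and the diameter bound on `|x-z|`. -/
theorem exp_sub_half_sq_le_one_add {u v w : ℝ} (hv : 0 ≤ v) (hw1 : w ≤ 1)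
    (h1 : u ≤ v * w) (h2 : -u ≤ v * w) (h3 : v ^ 2 + w ^ 2 - 2 * u ≤ 1) :
    Real.exp (u - v ^ 2 / 2) ≤ 1 + u := by
  rcases le_or_gt 0 u with hu | hu
  · have huv : u ≤ v := by nlinarith
    have hlog := Real.le_log_one_add_of_nonneg hu
    rw [← Real.le_log_iff_exp_le (by linarith)]
    refine le_trans ?_ hlog
    rw [le_div_iff₀ (by linarith)]
    have : u ^ 2 ≤ v ^ 2 := by gcongr
    nlinarith [mul_nonneg hu (sq_nonneg u)]
  · obtain ⟨c, rfl⟩ : ∃ c, u = -c := ⟨-u, by ring⟩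
    have hc : 0 < c := by linarith
    have hc1 : c < 1 := by nlinarith [sq_nonneg v, sq_nonneg w]
    -- Since `c ≤ v w` and `w² ≤ 1 - c`, this is a lower bound for `v²/2`; it is still large enough
    -- for the quadratic Taylor bound of `exp (c + e)` to exceed `1/(1-c)`.
    set e := c ^ 2 / (2 * (1 - c)) with he
    have hpos : 0 < 1 - c := by linarith
    have hev : e ≤ v ^ 2 / 2 := by
      rw [he, div_le_div_iff₀ (by linarith) (by norm_num)]
      have hcs : c ^ 2 ≤ (v * w) ^ 2 := by
        have : c ≤ v * w := by linarith
        gcongr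
      nlinarith [mul_nonneg (sq_nonneg v) (by nlinarith [sq_nonneg v] : 0 ≤ 1 - c - w ^ 2)]
    have he0 : 0 ≤ e := by positivity
    have hq := Real.quadratic_le_exp_of_nonneg (x := c + e) (by linarith)
    have hmain : (1 - c)⁻¹ ≤ Real.exp (c + e) := by
      refine le_trans ?_ hq
      have : 1 + (c + e) + (c + e) ^ 2 / 2 - (1 - c)⁻¹ = c ^ 4 / (8 * (1 - c) ^ 2) := by
        rw [he]; field_simp; ring
      have : 0 ≤ c ^ 4 / (8 * (1 - c) ^ 2) := by positivity
      linarith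
    calc Real.exp (-c - v ^ 2 / 2) ≤ Real.exp (-(c + e)) := Real.exp_le_exp.2 (by linarith)
      _ = (Real.exp (c + e))⁻¹ := Real.exp_neg _
      _ ≤ 1 - c := inv_le_of_inv_le₀ hpos hmain
      _ = 1 + -c := by ring

variable {M : Type*} [MetricSpace M]

/-- First-order upper bound for the exponential of the squared distance loss at `b`, in terms of
the variation of the squared distance to `x` along a geodesic from `b` to `z`. -/
theorem exp_neg_sq_dist_le (hM : IsNPC M) {D : ℝ} (hD : 0 < D) (hle : ∀ x y : M, dist x y ≤ D)
    (b z x : M) {γ : unitInterval → M} (hγ : IsGeodesic γ) (h0 : γ 0 = b) (h1 : γ 1 = z)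
    (t : unitInterval) (ht : 0 < (t : ℝ)) :
    Real.exp (-(1 / (2 * D ^ 2)) * dist x z ^ 2) ≤
      Real.exp (-(1 / (2 * D ^ 2)) * dist b z ^ 2) *
        (1 + (dist b x ^ 2 + (t : ℝ) ^ 2 * dist b z ^ 2 - dist (γ t) x ^ 2) /
          (2 * t * D ^ 2)) := by
  have hnpc := hM.curv_nonpos x b z γ hγ h0 h1 t
  have hbt : dist b (γ t) = t * dist b z := by
    have := hγ 0 t t.2.1
    rw [h0, h1] at this
    simpa using this
  have hA := dist_triangle b (γ t) x
  have hB := dist_triangle (γ t) b x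
  have hC := dist_triangle b x (γ t)
  rw [dist_comm (γ t) b] at hB
  rw [dist_comm x (γ t)] at hnpc hC
  rw [dist_comm x b] at hnpc
  rw [hbt] at hA hB hC
  set τ : ℝ := (t : ℝ)
  set l := dist b x
  set d := dist b z
  set p := dist (γ t) x
  set r := dist x z
  have hl : 0 ≤ l := dist_nonneg
  have hd : 0 ≤ d := dist_nonneg
  have hp : 0 ≤ p := dist_nonneg
  have hr : r ≤ D := hle _ _
  have hdD : d ≤ D := hle _ _
  have hr0 : 0 ≤ r := dist_nonneg
  -- Law of cosines: `q` stands for `⟨x-b, z-b⟩`. Curvature gives `hqr`; the triangle inequalities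
  -- give the Cauchy–Schwarz bounds `hq1` and `hq2`.
  set q := (l ^ 2 + τ ^ 2 * d ^ 2 - p ^ 2) / (2 * τ) with hq
  have hqr : l ^ 2 + d ^ 2 - r ^ 2 ≤ 2 * q := by
    rw [hq, ← sub_nonneg]
    have : 2 * ((l ^ 2 + τ ^ 2 * d ^ 2 - p ^ 2) / (2 * τ)) - (l ^ 2 + d ^ 2 - r ^ 2) =
      (((1 - τ) * l ^ 2 + τ * r ^ 2 - τ * (1 - τ) * d ^ 2) - p ^ 2) / τ := by
      field_simp; ring
    rw [this]
    exact div_nonneg (by linarith) ht.le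
  have hq1 : q ≤ l * d := by
    rw [hq, div_le_iff₀ (by linarith)]
    have : (l - τ * d) ^ 2 ≤ p ^ 2 := sq_le_sq' (by linarith) (by linarith)
    nlinarith
  have hq2 : -q ≤ l * d := by
    rw [hq, neg_le, le_div_iff₀ (by linarith)]
    have : p ^ 2 ≤ (l + τ * d) ^ 2 := by
      apply pow_le_pow_left₀ hp; linarith
    nlinarith
  have key := exp_sub_half_sq_le_one_add (u := q / D ^ 2) (v := l / D) (w := d / D)
    (by positivity) ((div_le_one hD).2 hdD)
    (by rw [div_mul_div_comm, ← sq]; gcongr)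
    (by rw [div_mul_div_comm, ← sq, ← neg_div]; gcongr)
    (by
      have : (l / D) ^ 2 + (d / D) ^ 2 - 2 * (q / D ^ 2) = (l ^ 2 + d ^ 2 - 2 * q) / D ^ 2 := by
        field_simp
      rw [this, div_le_one (by positivity)]
      have : r ^ 2 ≤ D ^ 2 := by gcongr
      linarith)
  calc Real.exp (-(1 / (2 * D ^ 2)) * r ^ 2)
      ≤ Real.exp (-(1 / (2 * D ^ 2)) * d ^ 2 + (q / D ^ 2 - (l / D) ^ 2 / 2)) := by
        rw [Real.exp_le_exp]
        have : -(1 / (2 * D ^ 2)) * d ^ 2 + (q / D ^ 2 - (l / D) ^ 2 / 2) =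
          -(1 / (2 * D ^ 2)) * (l ^ 2 + d ^ 2 - 2 * q) := by
          field_simp; ring
        rw [this]
        have : 0 ≤ 1 / (2 * D ^ 2) := by positivity
        nlinarith
    _ ≤ Real.exp (-(1 / (2 * D ^ 2)) * d ^ 2) * (1 + q / D ^ 2) := by
        rw [Real.exp_add]; gcongr
    _ = _ := by
        congr 2
        rw [hq, div_div]

theorem expertLoss_nonneg {Θ : Type*} (m : ℕ → Θ → M) (z : ℕ → M) (θ : Θ) (T : ℕ) :
    0 ≤ expertLoss (sqDistLoss M) m z θ T := by
  unfold expertLoss cumLoss sqDistLoss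
  exact Finset.sum_nonneg fun t _ => sq_nonneg _

variable [MeasurableSpace M] [BorelSpace M] {Θ : Type*} [MeasurableSpace Θ]

theorem measurable_dist_const_left {X : Θ → M} (hX : Measurable X) (a : M) :
    Measurable fun θ => dist a (X θ) :=
  (continuous_const.dist continuous_id).measurable.comp hX

theorem integrable_sq_dist {D : ℝ} (hle : ∀ x y : M, dist x y ≤ D) {X : Θ → M}
    (hX : Measurable X) (ν : Measure Θ) [IsFiniteMeasure ν] (a : M) :
    Integrable (fun θ => dist a (X θ) ^ 2) ν := by
  refine Integrable.of_bound (C := D ^ 2)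
    ((measurable_dist_const_left hX a).pow_const 2).aestronglyMeasurable (.of_forall fun θ => ?_)
  rw [Real.norm_of_nonneg (by positivity)]
  exact pow_le_pow_left₀ dist_nonneg (hle _ _) 2

theorem integrable_exp_of_nonpos {f : Θ → ℝ} (hf : Measurable f) (h : ∀ θ, f θ ≤ 0)
    (ν : Measure Θ) [IsFiniteMeasure ν] : Integrable (fun θ => Real.exp (f θ)) ν := by
  refine Integrable.of_bound (C := 1) hf.exp.aestronglyMeasurable (.of_forall fun θ => ?_)
  rw [Real.norm_of_nonneg (Real.exp_pos _).le]
  exact Real.exp_le_one_iff.2 (h θ)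

/-- Jensen's inequality at a barycenter for the exponential of the squared distance loss. -/
theorem integral_exp_neg_sq_dist_le (hM : IsNPC M) {D : ℝ} (hD : 0 < D)
    (hle : ∀ x y : M, dist x y ≤ D) (ν : Measure Θ) [IsProbabilityMeasure ν] {X : Θ → M}
    (hX : Measurable X) (b z : M)
    (hb : IsMinOn (fun a : M => ∫ θ, dist a (X θ) ^ 2 ∂ν) Set.univ b) :
    ∫ θ, Real.exp (-(1 / (2 * D ^ 2)) * dist (X θ) z ^ 2) ∂ν ≤
      Real.exp (-(1 / (2 * D ^ 2)) * dist b z ^ 2) := by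
  obtain ⟨γ, hγ, h0, h1⟩ := hM.geodesicSpace b z
  set E := Real.exp (-(1 / (2 * D ^ 2)) * dist b z ^ 2)
  have hint := fun a => integrable_sq_dist hle hX ν a
  have key : ∀ t ∈ Set.Ioc (0 : ℝ) 1,
      ∫ θ, Real.exp (-(1 / (2 * D ^ 2)) * dist (X θ) z ^ 2) ∂ν ≤
        E * (1 + t * (dist b z ^ 2 / (2 * D ^ 2))) := by
    intro t ht
    set t' : unitInterval := ⟨t, ht.1.le, ht.2⟩
    have ht0 := ht.1
    -- Minimality cancels the first-order term, leaving an error of order `t` that vanishes as `t →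
    -- 0`.
    have hmin : ∫ θ, dist b (X θ) ^ 2 ∂ν ≤ ∫ θ, dist (γ t') (X θ) ^ 2 ∂ν := hb (Set.mem_univ _)
    have hI2 : Integrable (fun θ =>
        dist b (X θ) ^ 2 + t ^ 2 * dist b z ^ 2 - dist (γ t') (X θ) ^ 2) ν :=
      ((hint b).add (integrable_const _)).sub (hint _)
    have hI : Integrable (fun θ => E * (1 + (dist b (X θ) ^ 2 + t ^ 2 * dist b z ^ 2 -
        dist (γ t') (X θ) ^ 2) / (2 * t * D ^ 2))) ν :=
      ((integrable_const _).add (hI2.div_const _)).const_mul _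
    have hval : ∫ θ, E * (1 + (dist b (X θ) ^ 2 + t ^ 2 * dist b z ^ 2 -
        dist (γ t') (X θ) ^ 2) / (2 * t * D ^ 2)) ∂ν =
        E * (1 + (∫ θ, dist b (X θ) ^ 2 ∂ν + t ^ 2 * dist b z ^ 2 -
          ∫ θ, dist (γ t') (X θ) ^ 2 ∂ν) / (2 * t * D ^ 2)) := by
      rw [integral_const_mul, integral_add (integrable_const _) (hI2.div_const _),
        integral_div, integral_sub (f := fun θ => dist b (X θ) ^ 2 + t ^ 2 * dist b z ^ 2)
          ((hint b).add (integrable_const _)) (hint _),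
        integral_add (hint b) (integrable_const _)]
      simp
    calc _ ≤ _ := integral_mono_of_nonneg (.of_forall fun θ => (Real.exp_pos _).le) hI
          (.of_forall fun θ => exp_neg_sq_dist_le hM hD hle b z (X θ) hγ h0 h1 t' ht.1)
      _ = _ := hval
      _ ≤ E * (1 + (t ^ 2 * dist b z ^ 2) / (2 * t * D ^ 2)) := by
        have : 0 < E := Real.exp_pos _
        gcongr
        linarith
      _ = _ := by field_simp
  refine ge_of_tendsto (x := nhdsWithin (0 : ℝ) (Set.Ioi 0))
    (f := fun t : ℝ => E * (1 + t * (dist b z ^ 2 / (2 * D ^ 2)))) ?_ ?_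
  · have : Filter.Tendsto (fun t : ℝ => E * (1 + t * (dist b z ^ 2 / (2 * D ^ 2))))
        (nhds 0) (nhds (E * (1 + 0 * (dist b z ^ 2 / (2 * D ^ 2))))) :=
      Continuous.tendsto (by fun_prop) _
    simpa using this.mono_left nhdsWithin_le_nhds
  · filter_upwards [Ioc_mem_nhdsGT (zero_lt_one (α := ℝ))] with t ht using key t ht

theorem measurable_expertLoss {m : ℕ → Θ → M} (hm : ∀ t, 1 ≤ t → Measurable (m t))
    (z : ℕ → M) (T : ℕ) : Measurable fun θ => expertLoss (sqDistLoss M) m z θ T := by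
  unfold expertLoss cumLoss sqDistLoss
  refine Finset.measurable_sum _ fun t ht => ?_
  simp_rw [dist_comm _ (z t)]
  exact (measurable_dist_const_left (hm t (Finset.mem_Icc.1 ht).1) _).pow_const 2

/-- The exponential weights dominate the cumulative loss of the forecaster. -/
theorem integral_exp_neg_expertLoss_le (hM : IsNPC M) {D : ℝ} (hD : 0 < D)
    (hle : ∀ x y : M, dist x y ≤ D) (π : Measure Θ) [IsProbabilityMeasure π]
    {m : ℕ → Θ → M} (hm : ∀ t, 1 ≤ t → Measurable (m t)) (z mhat : ℕ → M)
    (hmhat : IsEWAForecaster (sqDistLoss M) π (fun _ => 1 / (2 * D ^ 2)) m z mhat) (T : ℕ) :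
    ∫ θ, Real.exp (-(1 / (2 * D ^ 2)) * expertLoss (sqDistLoss M) m z θ T) ∂π ≤
      Real.exp (-(1 / (2 * D ^ 2)) * cumLoss (sqDistLoss M) mhat z T) := by
  have hint : ∀ T, Integrable (fun θ =>
      Real.exp (-(1 / (2 * D ^ 2)) * expertLoss (sqDistLoss M) m z θ T)) π := fun T =>
    integrable_exp_of_nonpos ((measurable_expertLoss hm z T).const_mul _) (fun θ =>
      mul_nonpos_of_nonpos_of_nonneg (neg_nonpos.2 (by positivity))
        (expertLoss_nonneg m z θ T)) π
  induction T with
  | zero => simp [expertLoss, cumLoss]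
  | succ n ih =>
    have hprob := isProbabilityMeasure_tilted (hint n)
    have hpos := integral_exp_pos (hint n)
    have hstep : ∫ θ, Real.exp (-(1 / (2 * D ^ 2)) * dist (m (n + 1) θ) (z (n + 1)) ^ 2)
        ∂(π.tilted fun θ => -(1 / (2 * D ^ 2)) * expertLoss (sqDistLoss M) m z θ n) ≤ _ :=
      integral_exp_neg_sq_dist_le hM hD hle _ (hm (n + 1) (by omega)) (mhat (n + 1))
        (z (n + 1)) (hmhat (n + 1) (by omega))
    have hsucc : ∀ θ, expertLoss (sqDistLoss M) m z θ (n + 1) =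
        expertLoss (sqDistLoss M) m z θ n + dist (m (n + 1) θ) (z (n + 1)) ^ 2 := fun θ => by
      simp [expertLoss, cumLoss, Finset.sum_Icc_succ_top, sqDistLoss]
    have hsucc' : cumLoss (sqDistLoss M) mhat z (n + 1) =
        cumLoss (sqDistLoss M) mhat z n + dist (mhat (n + 1)) (z (n + 1)) ^ 2 := by
      simp [cumLoss, Finset.sum_Icc_succ_top, sqDistLoss]
    -- Unfolding the tilt turns the one-round bound into a ratio of consecutive exponential
    -- integrals.
    rw [integral_tilted] at hstep
    simp_rw [smul_eq_mul, div_mul_eq_mul_div, ← Real.exp_add, ← mul_add, ← hsucc] at hstep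
    rw [integral_div, div_le_iff₀ hpos] at hstep
    rw [hsucc', mul_add, Real.exp_add, mul_comm (Real.exp _)]
    exact hstep.trans (mul_le_mul_of_nonneg_left ih (Real.exp_pos _).le)

/-- The Donsker–Varadhan inequality. -/
theorem integral_le_klDiv_add_log_integral_exp (q π : Measure Θ) [IsProbabilityMeasure q]
    [IsProbabilityMeasure π] (hkl : InformationTheory.klDiv q π ≠ ⊤) {f : Θ → ℝ}
    (hfq : Integrable f q) (hfπ : Integrable (fun θ => Real.exp (f θ)) π) :
    ∫ θ, f θ ∂q ≤
      (InformationTheory.klDiv q π).toReal + Real.log (∫ θ, Real.exp (f θ) ∂π) := by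
  obtain ⟨hac, hllr⟩ := InformationTheory.klDiv_ne_top_iff.1 hkl
  have hprob := isProbabilityMeasure_tilted hfπ
  have h := integral_llr_tilted_right hac hfq hfπ hllr
  have hac' : q ≪ π.tilted f := hac.trans (absolutelyContinuous_tilted hfπ)
  rw [← InformationTheory.toReal_klDiv_of_measure_eq hac' (by simp),
    ← InformationTheory.toReal_klDiv_of_measure_eq hac (by simp)] at h
  -- The gap in the inequality is exactly this divergence from `q` to the Gibbs measure.
  have : 0 ≤ (InformationTheory.klDiv q (π.tilted f)).toReal := ENNReal.toReal_nonneg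
  linarith

end OnlineNPC

open OnlineNPC in
theorem mainTheorem6 {M : Type*} [MetricSpace M] [CompleteSpace M] [MeasurableSpace M]
    [BorelSpace M] (hM : OnlineNPC.IsNPC M)
    (hbdd : Bornology.IsBounded (Set.univ : Set M))
    (hdiam : 0 < Metric.diam (Set.univ : Set M))
    {Θ : Type*} [MeasurableSpace Θ] (π : Measure Θ) [IsProbabilityMeasure π]
    (m : ℕ → Θ → M) (hm : ∀ t, 1 ≤ t → Measurable (m t)) (z : ℕ → M) (mhat : ℕ → M)
    (hmhat : OnlineNPC.IsEWAForecaster (OnlineNPC.sqDistLoss M) π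
      (fun _ => 1 / (2 * Metric.diam (Set.univ : Set M) ^ 2)) m z mhat)
    (T : ℕ) :
    ((OnlineNPC.cumLoss (OnlineNPC.sqDistLoss M) mhat z T : ℝ) : EReal) ≤
        ⨅ q : ProbabilityMeasure Θ,
          (((∫ θ, OnlineNPC.expertLoss (OnlineNPC.sqDistLoss M) m z θ T ∂(q : Measure Θ) : ℝ) :
              EReal)
            + ((2 * Metric.diam (Set.univ : Set M) ^ 2 : ℝ) : EReal)
              * ((InformationTheory.klDiv (q : Measure Θ) π : ENNReal) : EReal)) ∧
      ∀ [Finite Θ] [DiscreteMeasurableSpace Θ],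
        π = ProbabilityTheory.uniformOn Set.univ →
          OnlineNPC.regret (OnlineNPC.sqDistLoss M) mhat m z T ≤
            2 * Metric.diam (Set.univ : Set M) ^ 2 * Real.log (Nat.card Θ : ℝ) := by
  have hle : ∀ x y : M, dist x y ≤ Metric.diam (Set.univ : Set M) := fun x y =>
    Metric.dist_le_diam_of_mem hbdd (Set.mem_univ x) (Set.mem_univ y)
  have hW := integral_exp_neg_expertLoss_le hM hdiam hle π hm z mhat hmhat T
  set D := Metric.diam (Set.univ : Set M)
  have hmeas := measurable_expertLoss hm z T
  have hint : Integrable (fun θ =>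
      Real.exp (-(1 / (2 * D ^ 2)) * expertLoss (sqDistLoss M) m z θ T)) π :=
    integrable_exp_of_nonpos (hmeas.const_mul _) (fun θ =>
      mul_nonpos_of_nonpos_of_nonneg (neg_nonpos.2 (by positivity))
        (expertLoss_nonneg m z θ T)) π
  have hpos := integral_exp_pos hint
  have hlog := (Real.log_le_iff_le_exp hpos).2 hW
  have hscale : ∀ {a c : ℝ}, -(1 / (2 * D ^ 2)) * a ≤ c + -(1 / (2 * D ^ 2)) *
      cumLoss (sqDistLoss M) mhat z T →
      cumLoss (sqDistLoss M) mhat z T ≤ a + 2 * D ^ 2 * c := by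
    intro a c h
    have h' := mul_le_mul_of_nonneg_left h (by positivity : 0 ≤ 2 * D ^ 2)
    have e1 : 2 * D ^ 2 * (-(1 / (2 * D ^ 2)) * a) = -a := by field_simp
    have e2 : 2 * D ^ 2 * (c + -(1 / (2 * D ^ 2)) * cumLoss (sqDistLoss M) mhat z T) =
        2 * D ^ 2 * c - cumLoss (sqDistLoss M) mhat z T := by field_simp; ring
    linarith
  refine ⟨le_iInf fun q => ?_, ?_⟩
  · by_cases hkl : InformationTheory.klDiv (q : Measure Θ) π = ⊤
    · rw [hkl, EReal.coe_ennreal_top, EReal.coe_mul_top_of_pos (by positivity),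
        EReal.coe_add_top]
      exact le_top
    · have hintq : Integrable (fun θ => expertLoss (sqDistLoss M) m z θ T) (q : Measure Θ) := by
        unfold expertLoss cumLoss sqDistLoss
        refine integrable_finsetSum _ fun t ht => ?_
        simp_rw [dist_comm _ (z t)]
        exact integrable_sq_dist hle (hm t (Finset.mem_Icc.1 ht).1) _ _
      have hDV := integral_le_klDiv_add_log_integral_exp (q : Measure Θ) π hkl
        (hintq.const_mul (-(1 / (2 * D ^ 2)))) hint
      rw [integral_const_mul] at hDV
      rw [← ENNReal.ofReal_toReal hkl, EReal.coe_ennreal_ofReal,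
        max_eq_left ENNReal.toReal_nonneg]
      exact_mod_cast hscale (by linarith)
  · intro _ _ hπ
    have : Nonempty Θ := nonempty_of_isProbabilityMeasure π
    obtain ⟨θ, hθ⟩ := exists_eq_ciInf_of_finite
      (f := fun θ => expertLoss (sqDistLoss M) m z θ T)
    have hcard : (0 : ℝ) < Nat.card Θ := by exact_mod_cast Nat.card_pos
    have hmass : π.real {θ} = (Nat.card Θ : ℝ)⁻¹ := by
      have := Fintype.ofFinite Θ
      rw [hπ, measureReal_def, ProbabilityTheory.uniformOn_univ, Measure.count_singleton]
      simp [Nat.card_eq_fintype_card]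
    -- The best expert's atom alone bounds the integral from below; its mass `1/K` yields the `ln
    -- K`.
    have hlow : (Nat.card Θ : ℝ)⁻¹ *
        Real.exp (-(1 / (2 * D ^ 2)) * expertLoss (sqDistLoss M) m z θ T) ≤
        ∫ θ, Real.exp (-(1 / (2 * D ^ 2)) * expertLoss (sqDistLoss M) m z θ T) ∂π := by
      have := setIntegral_le_integral (s := {θ}) hint (.of_forall fun θ => (Real.exp_pos _).le)
      rwa [integral_singleton, hmass, smul_eq_mul] at this
    have h := Real.log_le_log (by positivity) (hlow.trans hW)
    rw [Real.log_mul (by positivity) (Real.exp_pos _).ne', Real.log_inv, Real.log_exp,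
      Real.log_exp] at h
    unfold regret
    rw [← hθ]
    have := hscale (a := expertLoss (sqDistLoss M) m z θ T) (c := Real.log (Nat.card Θ : ℝ))
      (by linarith)
    linarith
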